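/- Let $d\ge 1$ and consider the model case $\Omega=\mathbb R^d$, $q\equiv 0$, $a\equiv 1$ of the damped wave equation, i.e. $$\partial_{tt}u+\partial_t u=\Delta u,\qquad (u(0),\partial_t u(0))=(f,g)=F .$$ Let $\mathcal W$ be the Hilbert completion of $C_c^\infty(\mathbb R^d)$ for the norm $\|\varphi\|_{\mathcal W}=\|\nabla\varphi\|_{L^2}$, with dual $\mathcal W^*$, let $\mathcal H=\mathcal W\oplus L^2(\mathbb R^d)$, and let $$\mathcal K=\{(f,g)\in H^1(\mathbb R^d)\times L^2(\mathbb R^d): f+g\in\mathcal W^*\},\qquad \|(f,g)\|_{\mathcal K}^2=\|\nabla f\|_{L^2}^2+\|g\|_{L^2}^2+\|f\|_{L^2}^2+\|f+g\|_{\mathcal W^*}^2 .$$ For $F\in\mathcal K$ let $u(t)\in H^1(\mathbb R^d)$, $t\ge 0$, be the solution: $(u(t),\partial_t u(t))$ is the unique mild solution in $\mathcal H$ of $\partial_t U=\mathcal A U$, $U(0)=F$, where $\mathcal A(w,v)=(v,\Delta w-v)$ on $\mathrm{Dom}(\mathcal A)=\{(w,v)\in\mathcal W\times H^1(\mathbb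 R^d):\Delta w-v\in L^2(\mathbb R^d)\}$. For $j\in\{0,1,2\}$ put $$\mathfrak c_j=\Big(\sup_{s\ge 0}s^{j+1}e^{-2s}\Big)^{1/2}=\Big(\frac{j+1}{2e}\Big)^{\frac{j+1}{2}} .$$ Let $\rho_0,\rho_1,\rho_2$ be non-negative functions on $(0,\infty)$ such that for all $F\in\mathcal K$ and all $t>0$ $$\|u(t)\|_{L^2}\le\rho_0(t)\|F\|_{\mathcal K},\qquad \|\nabla u(t)\|_{L^2}\le\rho_1(t)\|F\|_{\mathcal K},\qquad \|\partial_t u(t)\|_{L^2}\le\rho_2(t)\|F\|_{\mathcal K}.$$ Then for every $\varepsilon>0$ there exists $t_0\ge 1$ such that for all $t\ge t_0$ $$\rho_0(t)\ge\frac{\mathfrak c_0-\varepsilon}{\sqrt t},\qquad \rho_1(t)\ge\frac{\mathfrak c_1-\varepsilon}{t},\qquad \rho_2(t)\ge\frac{\mathfrak c_2-\varepsilon}{t^{3/2}} .$$ -/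

import Mathlib

open MeasureTheory Set
open scoped Distributions

noncomputable section

namespace DampedWave

/-- Euclidean space `ℝ^d`. -/
abbrev Space (d : ℕ) : Type := EuclideanSpace ℝ (Fin d)

/-- `L²(ℝ^d)`, complex valued. -/
abbrev L2 (d : ℕ) : Type := Lp ℂ 2 (volume : Measure (Space d))

/-- `L²(ℝ^d)^d`, the space of square integrable complex vector fields. -/
abbrev L2Vec (d : ℕ) : Type := Lp (EuclideanSpace ℂ (Fin d)) 2 (volume : Measure (Space d))

/-- `C_c^∞(ℝ^d)`, complex valued. -/
abbrev Test (d : ℕ) : Type := 𝓓((⊤ : TopologicalSpace.Opens (Space d)), ℂ)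

/-- The pointwise gradient of a function `φ : ℝ^d → ℂ`. -/
def grad {d : ℕ} (φ : Space d → ℂ) (x : Space d) : EuclideanSpace ℂ (Fin d) :=
  WithLp.toLp 2 fun i => fderiv ℝ φ x (EuclideanSpace.single i 1)

theorem memLp_test {d : ℕ} (φ : Test d) : MemLp φ 2 (volume : Measure (Space d)) :=
  φ.continuous.memLp_of_hasCompactSupport φ.hasCompactSupport

theorem memLp_grad {d : ℕ} (φ : Test d) : MemLp (grad φ) 2 (volume : Measure (Space d)) := by
  have hc : Continuous (fderiv ℝ φ) := φ.contDiff.continuous_fderiv (by simp)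
  have hg : Continuous (grad φ) := by
    unfold grad
    fun_prop
  refine hg.memLp_of_hasCompactSupport ?_
  refine (φ.hasCompactSupport.fderiv (𝕜 := ℝ)).mono' ?_
  refine subset_trans ?_ (subset_tsupport _)
  intro x hx
  contrapose! hx
  have h0 : fderiv ℝ φ x = 0 := by simpa using hx
  simp only [Function.mem_support, not_not]
  ext i
  simp [grad, h0]

/-- A test function, as an element of `L²`. -/
def testL2 (d : ℕ) : Test d →ₗ[ℂ] L2 d where
  toFun φ := (memLp_test φ).toLp φ
  map_add' φ ψ := by
    rw [← MemLp.toLp_add]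
    rfl
  map_smul' c φ := by
    rw [RingHom.id_apply, ← MemLp.toLp_const_smul]
    rfl

/-- The gradient of a test function, as an element of `(L²)^d`. -/
def testGrad (d : ℕ) : Test d →ₗ[ℂ] L2Vec d where
  toFun φ := (memLp_grad φ).toLp (grad φ)
  map_add' φ ψ := by
    rw [← MemLp.toLp_add]
    congr 1
    funext x
    ext i
    have h1 : DifferentiableAt ℝ φ x := φ.contDiff.differentiable (by simp) x
    have h2 : DifferentiableAt ℝ ψ x := ψ.contDiff.differentiable (by simp) x
    have h : fderiv ℝ (φ + ψ : Test d) x = fderiv ℝ φ x + fderiv ℝ ψ x := fderiv_add h1 h2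
    change fderiv ℝ (φ + ψ : Test d) x _ = _
    rw [h]
    rfl
  map_smul' c φ := by
    rw [RingHom.id_apply, ← MemLp.toLp_const_smul]
    congr 1
    funext x
    ext i
    have h1 : DifferentiableAt ℝ φ x := φ.contDiff.differentiable (by simp) x
    have h : fderiv ℝ (c • φ : Test d) x = c • fderiv ℝ φ x := fderiv_const_smul h1 c
    change fderiv ℝ (c • φ : Test d) x _ = _
    rw [h]
    rfl

/-- The space `H¹₀(ℝ^d) = H¹(ℝ^d)`: the closure of `C_c^∞(ℝ^d)` in the `H¹`-norm. An element `f` is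
represented by the pair `(f, ∇f)`, that is, `H10 d` is the closure of `{(φ, ∇φ) : φ ∈ C_c^∞}` in
`L² × (L²)^d`. -/
def H10 (d : ℕ) : Submodule ℂ (L2 d × L2Vec d) :=
  (LinearMap.range ((testL2 d).prod (testGrad d))).topologicalClosure

/-- The Hilbert completion `W` of `C_c^∞(ℝ^d)` for the norm `‖φ‖_W = ‖∇φ‖_{L²}` (that is, for
`q = 0`). Since `φ ↦ ∇φ` is isometric from this norm into `(L²)^d`, the completion is realized as
the closure of `{∇φ : φ ∈ C_c^∞}` in `(L²)^d`: a class `w ∈ W` is represented by its gradient. -/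
def W (d : ℕ) : Submodule ℂ (L2Vec d) :=
  (LinearMap.range (testGrad d)).topologicalClosure

instance (d : ℕ) : CompleteSpace (W d) :=
  (Submodule.isClosed_topologicalClosure _).completeSpace_coe

/-- A test function, as an element of `W`. -/
def testW (d : ℕ) : Test d →ₗ[ℂ] W d :=
  (testGrad d).codRestrict (W d) fun φ =>
    (LinearMap.range (testGrad d)).le_topologicalClosure ⟨φ, rfl⟩

/-- The `L²` function underlying an element of `H¹₀`. -/
def fn {d : ℕ} (f : H10 d) : L2 d := (f : L2 d × L2Vec d).1

/-- The gradient `∇f` of an element `f` of `H¹₀`. -/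
def gradient {d : ℕ} (f : H10 d) : L2Vec d := (f : L2 d × L2Vec d).2

theorem gradient_mem_W {d : ℕ} (f : H10 d) : gradient f ∈ W d := by
  have hf : (f : L2 d × L2Vec d) ∈
      closure (LinearMap.range ((testL2 d).prod (testGrad d)) : Set (L2 d × L2Vec d)) := f.2
  change (f : L2 d × L2Vec d).2 ∈ closure (LinearMap.range (testGrad d) : Set (L2Vec d))
  refine map_mem_closure continuous_snd hf ?_
  rintro _ ⟨φ, rfl⟩
  exact ⟨φ, rfl⟩

/-- The natural map `H¹₀ → W`. -/
def toW {d : ℕ} (f : H10 d) : W d := ⟨gradient f, gradient_mem_W f⟩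

/-- The energy space `ℋ = W ⊕ L²`, with its Hilbert norm. -/
abbrev H (d : ℕ) : Type := WithLp 2 (W d × L2 d)

/-- `Generates U V` says that `U = (u, v)` lies in the domain of the damped wave operator
`𝒜 (u, v) = (v, Δu - v)` on `ℋ` (the case `q = 0`, `a = 1`) and that `𝒜 U = V`. The domain consists of
the `(u, v) ∈ W × H¹₀` for which the distribution `Δu - v` belongs to `L²`; here `⟨φ, Δu⟩` is
`-⟨∇φ, ∇u⟩`, and `inner` is conjugate linear in its first argument. -/
def Generates {d : ℕ} (U V : H d) : Prop :=
  (∃ v : H10 d, fn v = U.snd ∧ V.fst = toW v) ∧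
    ∀ φ : Test d,
      -inner ℂ (testW d φ) U.fst - inner ℂ (testL2 d φ) U.snd = inner ℂ (testL2 d φ) V.snd

/-- `U : [0,∞) → ℋ` is a mild solution of `∂_t U = 𝒜 U`, `U(0) = F`: it is continuous, its
primitive takes values in the domain of `𝒜`, and `U(t) = 𝒜 (∫₀ᵗ U(s) ds) + F` for `t ≥ 0`.
Values of `U` at negative times play no role. -/
def IsMildSolution {d : ℕ} (F : H d) (U : ℝ → H d) : Prop :=
  ContinuousOn U (Ici 0) ∧ ∀ t : ℝ, 0 ≤ t → Generates (∫ s in (0 : ℝ)..t, U s) (U t - F)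

/-- `u` is the solution of the damped wave equation `∂_tt u + ∂_t u = Δu` with initial data
`(u(0), ∂_t u(0)) = (f, g) ∈ H¹₀ × L²`: the image of `u(t)` in `W` is, for all `t ≥ 0`, the first
component of the mild solution with initial value `(f, g)` in `ℋ`. -/
def IsSolution {d : ℕ} (F : H10 d × L2 d) (u : ℝ → H10 d) : Prop :=
  ∃ U : ℝ → H d, IsMildSolution (WithLp.toLp 2 (toW F.1, F.2)) U ∧
    ∀ t : ℝ, 0 ≤ t → (U t).fst = toW (u t)

/-- The bounded (antilinear) functional `ℓ` on `W` extends the distribution `h ∈ L²`. -/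
def Extends {d : ℕ} (h : L2 d) (l : W d →L⋆[ℂ] ℂ) : Prop :=
  ∀ φ : Test d, l (testW d φ) = inner ℂ (testL2 d φ) h

/-- The norm of `h` in the dual space `W*`, for an `h ∈ L²` that belongs to `W*`. (The bounded
extension is unique, so that the infimum is over one functional.) -/
def dualNorm {d : ℕ} (h : L2 d) : ℝ :=
  sInf {r : ℝ | ∃ l : W d →L⋆[ℂ] ℂ, Extends h l ∧ r = ‖l‖}

/-- The space `𝒦 = {(f, g) ∈ H¹₀ × L² : f + g ∈ W*}`. -/
def K (d : ℕ) : Set (H10 d × L2 d) :=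
  {F | ∃ l : W d →L⋆[ℂ] ℂ, Extends (fn F.1 + F.2) l}

/-- The norm of `𝒦`:
`‖(f, g)‖_𝒦² = ‖∇f‖² + ‖g‖² + ‖f‖² + ‖f + g‖_{W*}²`. -/
def normK {d : ℕ} (F : H10 d × L2 d) : ℝ :=
  √(‖gradient F.1‖ ^ 2 + ‖F.2‖ ^ 2 + ‖fn F.1‖ ^ 2 + dualNorm (fn F.1 + F.2) ^ 2)

/-- The constants `𝔠_j = (sup_{s ≥ 0} s^{j+1} e^{-2s})^{1/2}`. -/
def c (j : ℕ) : ℝ := √(sSup ((fun s : ℝ => s ^ (j + 1) * Real.exp (-2 * s)) '' Ici 0))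

/-- The explicit value `𝔠_j = ((j+1)/(2e))^{(j+1)/2}`. -/
theorem c_eq (j : ℕ) :
    c j = (((j : ℝ) + 1) / (2 * Real.exp 1)) ^ (((j : ℝ) + 1) / 2) := by
  have hj : (0 : ℝ) < (j : ℝ) + 1 := by positivity
  have key : ∀ s : ℝ, 0 ≤ s → s * Real.exp (-2 * s / (j + 1)) ≤ (j + 1) / (2 * Real.exp 1) := by
    intro s _
    have h := Real.add_one_le_exp (2 * s / (j + 1) - 1)
    have e1 : Real.exp (2 * s / (j + 1) - 1) * Real.exp (-2 * s / (j + 1)) * Real.exp 1 = 1 := by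
      rw [← Real.exp_add, ← Real.exp_add, Real.exp_eq_one_iff]
      ring
    have h3 : 2 * s / (j + 1) * (Real.exp (-2 * s / (j + 1)) * Real.exp 1) ≤ 1 := by
      rw [mul_assoc] at e1
      refine le_trans (mul_le_mul_of_nonneg_right ?_ (by positivity)) e1.le
      linarith
    rw [le_div_iff₀ (by positivity)]
    have h4 : 2 * s / (j + 1) * (Real.exp (-2 * s / (j + 1)) * Real.exp 1)
        = (s * Real.exp (-2 * s / (j + 1)) * (2 * Real.exp 1)) / (j + 1) := by ring
    rw [h4, div_le_iff₀ hj] at h3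
    linarith
  have hpow : ∀ s : ℝ, s ^ (j + 1) * Real.exp (-2 * s)
      = (s * Real.exp (-2 * s / (j + 1))) ^ (j + 1) := by
    intro s
    rw [mul_pow, ← Real.exp_nat_mul]
    congr 2
    push_cast
    field_simp
  have hsup : IsGreatest ((fun s : ℝ => s ^ (j + 1) * Real.exp (-2 * s)) '' Ici 0)
      ((((j : ℝ) + 1) / (2 * Real.exp 1)) ^ (j + 1)) := by
    constructor
    · refine ⟨((j : ℝ) + 1) / 2, by simp only [mem_Ici]; positivity, ?_⟩
      simp only
      rw [hpow]
      congr 1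
      have : -2 * (((j : ℝ) + 1) / 2) / (j + 1) = -1 := by field_simp
      rw [this, Real.exp_neg]
      field_simp
    · rintro _ ⟨s, hs, rfl⟩
      simp only
      rw [hpow]
      exact pow_le_pow_left₀ (mul_nonneg hs (Real.exp_pos _).le) (key s hs) _
  rw [c, hsup.csSup_eq, Real.sqrt_eq_rpow, ← Real.rpow_natCast, ← Real.rpow_mul (by positivity)]
  congr 1
  push_cast
  ring

end DampedWave

end

/-!
The lower bounds come from solutions with a single, slowly decaying frequency. On the Fourier side
the damped wave equation at frequency `ξ` has the characteristic equation `λ² + λ + |2πξ|² = 0`;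
write its slow root as `-μ`, with `0 < μ < 1/2` and `|2πξ|² = r² = μ (1 - μ)`. For a mode `e^{-μt} f`
with `g = -μ f`, the data satisfy
`‖F‖_𝒦² = (r² + μ² + 1 + (1 - μ)² / r²) ‖f‖² = (μ + 1/μ) ‖f‖²`, so that `‖u(t)‖ / ‖F‖_𝒦`
equals `√μ e^{-μt} / √(1 + μ²)`, while `‖∇u(t)‖` and `‖∂ₜu(t)‖` carry the additional factors `√(μ (1 - μ))`
and `μ`. With `μ = s / t` and `s = (j + 1) / 2`, the point where `s^{j+1} e^{-2s}` is maximal, these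
ratios are `𝔠_j / t^{(j+1)/2}` up to a factor that tends to `1`.

A single mode is not square integrable, so it is replaced by functions whose frequencies lie in a
small open set around it (`frequencies`). Multiplication by the slow root is then a bounded operator
`Λ` on a space `X` of functions in `H¹₀` (`packetMap`, `packetGenerator`), and it satisfies
`Λ² + Λ = Δ` weakly (`isPacket`). This alone makes `t ↦ exp (t Λ) x` a mild solution
(`IsPacket.isSolution`): no theory of the wave semigroup is needed. For the data `x = Λ z` the norm
of `f + g = Λ z + Λ² z = Δ z` in `W*` is at most `‖∇z‖` (`IsPacket.dualNorm_le`). Shrinking the set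
of frequencies gives the ratios of the exact mode (`mode_le_rate`).

That such functions lie in `H¹₀` follows from the density of Schwartz functions in `L²`, since for
Schwartz functions cutoffs converge in the `H¹`-norm (`toLp_mem_H10`, `bandLimitL_mem`).
-/

noncomputable section

namespace DampedWave

/-! ### Solutions generated by a bounded root of `Λ² + Λ = Δ` -/

/-- The inclusion `H¹₀ → L²`, as a continuous linear map. -/
def fnL (d : ℕ) : H10 d →L[ℂ] L2 d :=
  (ContinuousLinearMap.fst ℂ (L2 d) (L2Vec d)).comp (H10 d).subtypeL

/-- The natural map `H¹₀ → W`, as a continuous linear map. -/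
def toWL (d : ℕ) : H10 d →L[ℂ] W d :=
  ((ContinuousLinearMap.snd ℂ (L2 d) (L2Vec d)).comp (H10 d).subtypeL).codRestrict (W d)
    gradient_mem_W

/-- A *wave packet space*: a complex normed space `X`, mapped to `H¹₀` by a bounded map `J`, with a
bounded operator `Λ` on `X` that solves `Λ² + Λ = Δ` there (in the weak sense). If `X` is complete,
`t ↦ J (exp (t Λ) x)` solves the damped wave equation for `x` in the range of `Λ`. -/
structure IsPacket {d : ℕ} {X : Type*} [NormedAddCommGroup X] [NormedSpace ℂ X]
    (J : X →L[ℂ] H10 d) (Λ : X →L[ℂ] X) : Prop where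
  weak : ∀ (φ : Test d) (y : X),
    -inner ℂ (testGrad d φ) (gradient (J y)) = inner ℂ (testL2 d φ) (fn (J (Λ y + Λ (Λ y))))

section Packet

variable {d : ℕ} {X : Type*} [NormedAddCommGroup X] [NormedSpace ℂ X]
  {J : X →L[ℂ] H10 d} {Λ : X →L[ℂ] X}

/-- The Cauchy data `(J y, J (Λ y))` in the energy space of the solution `t ↦ J (exp (t Λ) y)`. -/
def energyData (J : X →L[ℂ] H10 d) (Λ : X →L[ℂ] X) : X →L[ℂ] H d :=
  (WithLp.prodContinuousLinearEquiv 2 ℂ (W d) (L2 d)).symm.toContinuousLinearMap.comp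
    (((toWL d).comp J).prod ((fnL d).comp (J.comp Λ)))

theorem energyData_apply (y : X) :
    energyData J Λ y = WithLp.toLp 2 (toW (J y), fn (J (Λ y))) := rfl

theorem IsPacket.generates (h : IsPacket J Λ) (y : X) :
    Generates (energyData J Λ y) (energyData J Λ (Λ y)) := by
  refine ⟨⟨J (Λ y), rfl, rfl⟩, fun φ => ?_⟩
  have h1 := h.weak φ y
  have h2 : fn (J (Λ y + Λ (Λ y))) = fn (J (Λ y)) + fn (J (Λ (Λ y))) := by
    rw [map_add]; rfl
  rw [h2, inner_add_right] at h1
  have h3 : inner ℂ (testW d φ) (toW (J y)) = inner ℂ (testGrad d φ) (gradient (J y)) := rfl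
  change -inner ℂ (testW d φ) (toW (J y)) - inner ℂ (testL2 d φ) (fn (J (Λ y)))
    = inner ℂ (testL2 d φ) (fn (J (Λ (Λ y))))
  rw [h3, h1]
  ring

/-- The functional `w ↦ -⟨w, J z⟩` on `W` extends `J (Λ z) + J (Λ² z)`, which therefore belongs to
`W*`. -/
theorem IsPacket.extends_neg_inner (h : IsPacket J Λ) (z : X) :
    Extends (fn (J (Λ z)) + fn (J (Λ (Λ z)))) (-innerSLFlip ℂ (toW (J z))) := by
  intro φ
  have h2 : fn (J (Λ z)) + fn (J (Λ (Λ z))) = fn (J (Λ z + Λ (Λ z))) := by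
    rw [map_add]; rfl
  rw [h2, ← h.weak φ z]
  rfl

theorem IsPacket.mem_K (h : IsPacket J Λ) (z : X) : (J (Λ z), fn (J (Λ (Λ z)))) ∈ K d :=
  ⟨_, h.extends_neg_inner z⟩

theorem IsPacket.dualNorm_le (h : IsPacket J Λ) (z : X) :
    dualNorm (fn (J (Λ z)) + fn (J (Λ (Λ z)))) ≤ ‖gradient (J z)‖ := by
  have hbdd : BddBelow {r : ℝ | ∃ l : W d →L⋆[ℂ] ℂ,
      Extends (fn (J (Λ z)) + fn (J (Λ (Λ z)))) l ∧ r = ‖l‖} := by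
    refine ⟨0, ?_⟩
    rintro _ ⟨l, -, rfl⟩
    exact norm_nonneg l
  refine (csInf_le hbdd ⟨_, h.extends_neg_inner z, rfl⟩).trans ?_
  refine ContinuousLinearMap.opNorm_le_bound _ (norm_nonneg _) fun w => ?_
  rw [neg_apply, norm_neg, innerSLFlip_apply_apply, mul_comm]
  exact norm_inner_le_norm w (toW (J z))

theorem dualNorm_nonneg (h : L2 d) : 0 ≤ dualNorm h := by
  refine Real.sInf_nonneg ?_
  rintro _ ⟨l, -, rfl⟩
  exact norm_nonneg l

theorem apply_exp_smul_apply (Λ : X →L[ℂ] X) (x : X) (t : ℝ) :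
    Λ (NormedSpace.exp (t • Λ) x) = NormedSpace.exp (t • Λ) (Λ x) := by
  have h : Commute Λ (NormedSpace.exp (t • Λ)) := ((Commute.refl Λ).smul_right t).exp_right
  exact congrArg (fun A : X →L[ℂ] X => A x) h

section Complete

variable [CompleteSpace X]

theorem hasDerivAt_exp_smul_apply (Λ : X →L[ℂ] X) (x : X) (t : ℝ) :
    HasDerivAt (fun s : ℝ => NormedSpace.exp (s • Λ) x) (NormedSpace.exp (t • Λ) (Λ x)) t := by
  have h := hasDerivAt_exp_smul_const (𝕂 := ℝ) Λ t
  have h2 := (((ContinuousLinearMap.apply ℂ X x).restrictScalars ℝ).hasFDerivAt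
    (x := NormedSpace.exp (t • Λ))).comp_hasDerivAt t h
  exact h2

theorem continuous_exp_smul_apply (Λ : X →L[ℂ] X) (x : X) :
    Continuous fun s : ℝ => NormedSpace.exp (s • Λ) x :=
  continuous_iff_continuousAt.2 fun t => (hasDerivAt_exp_smul_apply Λ x t).continuousAt

/-- The exponential of `Λ` produces solutions of the damped wave equation. -/
theorem IsPacket.isSolution (h : IsPacket J Λ) (z : X) :
    IsSolution (J (Λ z), fn (J (Λ (Λ z)))) fun t => J (NormedSpace.exp (t • Λ) (Λ z)) := by
  refine ⟨fun t => energyData J Λ (NormedSpace.exp (t • Λ) (Λ z)), ⟨?_, fun t _ => ?_⟩,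
    fun t _ => rfl⟩
  · exact ((energyData J Λ).continuous.comp (continuous_exp_smul_apply Λ _)).continuousOn
  · have hc := continuous_exp_smul_apply Λ (Λ z)
    -- `Λ z` is in the range of `Λ`, so the orbit has the explicit primitive `exp (t Λ) z - z`.
    have hint : ∫ s in (0 : ℝ)..t, NormedSpace.exp (s • Λ) (Λ z)
        = NormedSpace.exp (t • Λ) z - z := by
      rw [intervalIntegral.integral_eq_sub_of_hasDerivAt
        (fun s _ => hasDerivAt_exp_smul_apply Λ z s) (hc.intervalIntegrable _ _)]
      simp
    have hU : ∫ s in (0 : ℝ)..t, energyData J Λ (NormedSpace.exp (s • Λ) (Λ z))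
        = energyData J Λ (NormedSpace.exp (t • Λ) z - z) := by
      rw [ContinuousLinearMap.intervalIntegral_comp_comm _ (hc.intervalIntegrable _ _), hint]
    have hV : energyData J Λ (NormedSpace.exp (t • Λ) (Λ z))
          - WithLp.toLp 2 (toW (J (Λ z)), fn (J (Λ (Λ z))))
        = energyData J Λ (Λ (NormedSpace.exp (t • Λ) z - z)) := by
      rw [← energyData_apply, ← map_sub, map_sub Λ, apply_exp_smul_apply]
    rw [hU, hV]
    exact h.generates _

theorem deriv_fn_exp_smul_apply (x : X) (t : ℝ) :
    deriv (fun s : ℝ => fn (J (NormedSpace.exp (s • Λ) x))) t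
      = fn (J (NormedSpace.exp (t • Λ) (Λ x))) :=
  ((((fnL d).comp J).restrictScalars ℝ).hasFDerivAt.comp_hasDerivAt t
    (hasDerivAt_exp_smul_apply Λ x t)).deriv

end Complete

/-! ### Lower bounds for the decay rates from a concentrated packet -/

/-- A packet space concentrated, up to `δ`, on the mode with `Λ = -μ` and frequency `|∇| = r`. -/
structure IsConcentrated (J : X →L[ℂ] H10 d) (Λ : X →L[ℂ] X) (μ r δ : ℝ) : Prop
    extends IsPacket J Λ where
  norm_fn : ∀ y, ‖fn (J y)‖ = ‖y‖
  le_norm_gradient : ∀ y, (r - δ) * ‖y‖ ≤ ‖gradient (J y)‖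
  norm_gradient_le : ∀ y, ‖gradient (J y)‖ ≤ (r + δ) * ‖y‖
  le_norm_apply : ∀ y, (μ - δ) * ‖y‖ ≤ ‖Λ y‖
  norm_apply_le : ∀ y, ‖Λ y‖ ≤ (μ + δ) * ‖y‖

/-- The bound for the `𝒦`-norm of the packet data, before the limit `δ → 0`. -/
def dataBound (μ r δ : ℝ) : ℝ :=
  √(((r + δ) * (μ + δ)) ^ 2 + ((μ + δ) ^ 2) ^ 2 + (μ + δ) ^ 2 + (r + δ) ^ 2)

theorem IsConcentrated.normK_le {μ r δ : ℝ} (h : IsConcentrated J Λ μ r δ) (hμ : 0 ≤ μ + δ)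
    (hr : 0 ≤ r + δ) {z : X} (hz : ‖z‖ = 1) :
    normK (J (Λ z), fn (J (Λ (Λ z)))) ≤ dataBound μ r δ := by
  have h1 : ‖Λ z‖ ≤ μ + δ := by simpa [hz] using h.norm_apply_le z
  have h2 : ‖Λ (Λ z)‖ ≤ (μ + δ) ^ 2 :=
    (h.norm_apply_le _).trans (by rw [sq]; gcongr)
  have h3 : ‖gradient (J (Λ z))‖ ≤ (r + δ) * (μ + δ) :=
    (h.norm_gradient_le _).trans (by gcongr)
  have h4 : dualNorm (fn (J (Λ z)) + fn (J (Λ (Λ z)))) ≤ r + δ :=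
    (h.toIsPacket.dualNorm_le z).trans (by simpa [hz] using h.norm_gradient_le z)
  have h5 := dualNorm_nonneg (fn (J (Λ z)) + fn (J (Λ (Λ z))))
  unfold normK dataBound
  simp only [h.norm_fn]
  gcongr

variable [CompleteSpace X]

theorem norm_exp_le_exp_norm (A : X →L[ℂ] X) : ‖NormedSpace.exp A‖ ≤ Real.exp ‖A‖ := by
  rw [Real.exp_eq_exp_ℝ]
  refine HasSum.norm_le_of_bounded (NormedSpace.exp_series_hasSum_exp' (𝕂 := ℂ) A)
    (NormedSpace.exp_series_hasSum_exp' (𝕂 := ℝ) ‖A‖) fun n => ?_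
  have h : ‖A ^ n‖ ≤ ‖A‖ ^ n := by
    rcases Nat.eq_zero_or_pos n with rfl | hn
    · rw [pow_zero, pow_zero]
      exact ContinuousLinearMap.norm_id_le
    · exact norm_pow_le' A hn
  rw [norm_smul]
  simpa using mul_le_mul_of_nonneg_left h (by positivity : (0 : ℝ) ≤ (n.factorial : ℝ)⁻¹)

/-- A solution of `x' = Λ x` with `‖Λ‖ ≤ a` decays at most like `e^{-at}`. -/
theorem exp_neg_mul_norm_le {a : ℝ} (ha : 0 ≤ a) (hΛ : ∀ y, ‖Λ y‖ ≤ a * ‖y‖) {t : ℝ} (ht : 0 ≤ t)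
    (x : X) : Real.exp (-(t * a)) * ‖x‖ ≤ ‖NormedSpace.exp (t • Λ) x‖ := by
  have hn : ‖Λ‖ ≤ a := Λ.opNorm_le_bound ha hΛ
  have h1 : NormedSpace.exp (-(t • Λ)) * NormedSpace.exp (t • Λ) = 1 := by
    let := NormedAlgebra.restrictScalars ℚ ℂ (X →L[ℂ] X)
    rw [← NormedSpace.exp_add_of_commute (Commute.refl (t • Λ)).neg_left, neg_add_cancel,
      NormedSpace.exp_zero]
  have h2 : x = NormedSpace.exp (-(t • Λ)) (NormedSpace.exp (t • Λ) x) :=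
    (congrArg (fun A : X →L[ℂ] X => A x) h1).symm
  have h3 : ‖NormedSpace.exp (-(t • Λ))‖ ≤ Real.exp (t * a) := by
    refine (norm_exp_le_exp_norm _).trans (Real.exp_le_exp.2 ?_)
    rw [norm_neg, norm_smul, Real.norm_of_nonneg ht]
    gcongr
  have h4 : ‖x‖ ≤ Real.exp (t * a) * ‖NormedSpace.exp (t • Λ) x‖ := by
    conv_lhs => rw [h2]
    exact (ContinuousLinearMap.le_opNorm _ _).trans (by gcongr)
  rw [Real.exp_neg, inv_mul_le_iff₀ (Real.exp_pos _)]
  exact h4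

/-- The rates `(‖u(t)‖, ‖∇u(t)‖, ‖∂ₜu(t)‖) / ‖F‖` enforced by a concentrated packet. -/
theorem IsConcentrated.le_rate {μ r δ : ℝ} (h : IsConcentrated J Λ μ r δ) (hδ : 0 < δ)
    (hμ : δ < μ) (hr : δ < r) {z : X} (hz : ‖z‖ = 1) {t a₀ a₁ a₂ : ℝ} (ht : 0 < t)
    (h₀ : 0 ≤ a₀) (h₁ : 0 ≤ a₁) (h₂ : 0 ≤ a₂)
    (hbound : ∀ F ∈ K d, ∀ u : ℝ → H10 d, IsSolution F u →
      ‖fn (u t)‖ ≤ a₀ * normK F ∧ ‖gradient (u t)‖ ≤ a₁ * normK F ∧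
      ‖deriv (fun s : ℝ => fn (u s)) t‖ ≤ a₂ * normK F) :
    Real.exp (-(t * (μ + δ))) * (μ - δ) ≤ a₀ * dataBound μ r δ ∧
    (r - δ) * (Real.exp (-(t * (μ + δ))) * (μ - δ)) ≤ a₁ * dataBound μ r δ ∧
    (μ - δ) * (Real.exp (-(t * (μ + δ))) * (μ - δ)) ≤ a₂ * dataBound μ r δ := by
  have hK := h.normK_le (by linarith) (by linarith) hz
  have h3 : μ - δ ≤ ‖Λ z‖ := by simpa [hz] using h.le_norm_apply z
  have h4 : ∀ x, Real.exp (-(t * (μ + δ))) * ‖x‖ ≤ ‖NormedSpace.exp (t • Λ) x‖ :=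
    exp_neg_mul_norm_le (by linarith) h.norm_apply_le ht.le
  have h5 : Real.exp (-(t * (μ + δ))) * (μ - δ) ≤ ‖NormedSpace.exp (t • Λ) (Λ z)‖ :=
    le_trans (by gcongr) (h4 (Λ z))
  obtain ⟨b₀, b₁, b₂⟩ := hbound _ (h.toIsPacket.mem_K z) _ (h.toIsPacket.isSolution z)
  rw [deriv_fn_exp_smul_apply, h.norm_fn] at b₂
  rw [h.norm_fn] at b₀
  refine ⟨?_, ?_, ?_⟩
  · exact h5.trans (b₀.trans (by gcongr))
  · calc _ ≤ (r - δ) * ‖NormedSpace.exp (t • Λ) (Λ z)‖ :=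
          mul_le_mul_of_nonneg_left h5 (by linarith)
      _ ≤ _ := h.le_norm_gradient _
      _ ≤ _ := b₁.trans (by gcongr)
  · calc _ ≤ (μ - δ) * ‖NormedSpace.exp (t • Λ) (Λ z)‖ :=
          mul_le_mul_of_nonneg_left h5 (by linarith)
      _ ≤ _ := h.le_norm_apply _
      _ ≤ a₂ * dataBound μ r δ := by
          rw [apply_exp_smul_apply]
          exact b₂.trans (by gcongr)

end Packet

/-! ### Schwartz functions belong to `H¹₀` -/

open FourierTransform SchwartzMap Filter Topology
open scoped ENNReal

/-- Dominated convergence in `L²`. -/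
theorem tendsto_toLp_of_dominated {α E : Type*} [MeasurableSpace α] {ν : Measure α}
    [NormedAddCommGroup E] {f : ℕ → α → E} {g : α → E} {b : α → ℝ} (hf : ∀ n, MemLp (f n) 2 ν)
    (hg : MemLp g 2 ν) (hb : MemLp b 2 ν) (hle : ∀ n x, ‖f n x - g x‖ ≤ b x)
    (hlim : ∀ x, Tendsto (fun n => f n x) atTop (𝓝 (g x))) :
    Tendsto (fun n => (hf n).toLp (f n)) atTop (𝓝 (hg.toLp g)) := by
  rw [Lp.tendsto_Lp_iff_tendsto_eLpNorm'']
  have h2 : (2 : ℝ≥0∞) ≠ 0 := two_ne_zero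
  simp only [eLpNorm_eq_lintegral_rpow_enorm_toReal h2 ENNReal.ofNat_ne_top, ENNReal.toReal_ofNat]
  have h0 : Tendsto (fun n => ∫⁻ x, ‖(f n - g) x‖ₑ ^ (2 : ℝ) ∂ν) atTop
      (𝓝 (∫⁻ _, 0 ∂ν)) := by
    refine tendsto_lintegral_of_dominated_convergence' (fun x => ‖b x‖ₑ ^ (2 : ℝ)) (fun n => ?_)
      (fun n => ?_) ?_ ?_
    · exact ((hf n).sub hg).1.enorm.pow_const _
    · refine Eventually.of_forall fun x => ?_
      have : ‖(f n - g) x‖ₑ ≤ ‖b x‖ₑ := by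
        rw [enorm_le_iff_norm_le, Real.norm_eq_abs]
        exact (hle n x).trans (le_abs_self _)
      exact ENNReal.rpow_le_rpow this zero_le_two
    · have := lintegral_rpow_enorm_lt_top_of_eLpNorm_lt_top h2 ENNReal.ofNat_ne_top hb.2
      simpa using this.ne
    · refine Eventually.of_forall fun x => ?_
      have h1 : Tendsto (fun n => ‖(f n - g) x‖ₑ) atTop (𝓝 0) := by
        have : Tendsto (fun n => f n x - g x) atTop (𝓝 0) := by
          simpa using (hlim x).sub_const (g x)
        simpa using this.enorm
      simpa using h1.ennrpow_const 2
  rw [lintegral_zero] at h0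
  simpa using h0.ennrpow_const (1 / 2)

/-- The linear map that turns a derivative into a gradient vector. -/
def gradL (d : ℕ) : (Space d →L[ℝ] ℂ) →L[ℝ] EuclideanSpace ℂ (Fin d) :=
  (PiLp.continuousLinearEquiv 2 ℝ (fun _ : Fin d => ℂ)).symm.toContinuousLinearMap.comp
    (ContinuousLinearMap.pi fun i =>
      ContinuousLinearMap.apply ℝ ℂ (EuclideanSpace.single i (1 : ℝ) : Space d))

theorem gradL_fderiv {d : ℕ} (φ : Space d → ℂ) (x : Space d) :
    gradL d (fderiv ℝ φ x) = grad φ x := rfl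

/-- The gradient of a Schwartz function, as a Schwartz function. -/
def gradS {d : ℕ} (w : 𝓢(Space d, ℂ)) : 𝓢(Space d, EuclideanSpace ℂ (Fin d)) :=
  (fderivCLM ℝ (Space d) ℂ w).postcompCLM (gradL d)

theorem gradS_apply {d : ℕ} (w : 𝓢(Space d, ℂ)) (x : Space d) : gradS w x = grad w x := rfl

/-- A smooth cutoff: equal to `1` on the unit ball, with support in the ball of radius `2`. -/
def bump (d : ℕ) : ContDiffBump (0 : Space d) := ⟨1, 2, one_pos, one_lt_two⟩

theorem bump_eq_one {d : ℕ} {x : Space d} (hx : ‖x‖ ≤ 1) : bump d x = 1 :=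
  (bump d).one_of_mem_closedBall (by simpa [bump] using hx)

/-- The bump function, rescaled to radius of order `n + 1`. -/
def cutoff (d n : ℕ) (x : Space d) : ℝ := bump d ((n + 1 : ℝ)⁻¹ • x)

theorem contDiff_cutoff (d n : ℕ) : ContDiff ℝ (⊤ : ℕ∞) (cutoff d n) :=
  (bump d).contDiff.comp (contDiff_const_smul (n + 1 : ℝ)⁻¹)

theorem hasCompactSupport_cutoff (d n : ℕ) : HasCompactSupport (cutoff d n) :=
  (bump d).hasCompactSupport.comp_homeomorph
    (Homeomorph.smulOfNeZero ((n + 1 : ℝ)⁻¹) (by positivity))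

/-- The product of a Schwartz function with `cutoff d n`, a test function. -/
def truncate {d : ℕ} (w : 𝓢(Space d, ℂ)) (n : ℕ) : Test d where
  toFun x := cutoff d n x • w x
  contDiff' := (contDiff_cutoff d n).smul w.smooth'
  hasCompactSupport' := (hasCompactSupport_cutoff d n).smul_right
  tsupport_subset' := fun _ _ => trivial

theorem truncate_apply {d : ℕ} (w : 𝓢(Space d, ℂ)) (n : ℕ) (x : Space d) :
    truncate w n x = (bump d ((n + 1 : ℝ)⁻¹ • x) : ℝ) • w x := rfl

theorem truncate_eventuallyEq {d : ℕ} (w : 𝓢(Space d, ℂ)) (x : Space d) :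
    ∀ᶠ n : ℕ in atTop, truncate w n =ᶠ[𝓝 x] w := by
  obtain ⟨N, hN⟩ := exists_nat_gt ‖x‖
  filter_upwards [eventually_ge_atTop N] with n hn
  have hx : ∀ᶠ y in 𝓝 x, ‖y‖ < (n + 1 : ℝ) := by
    refine continuous_norm.continuousAt.eventually_lt continuousAt_const ?_
    have : (N : ℝ) ≤ n := by exact_mod_cast hn
    linarith
  filter_upwards [hx] with y hy
  rw [truncate_apply, bump_eq_one, one_smul]
  rw [norm_smul, Real.norm_of_nonneg (by positivity), inv_mul_le_iff₀ (by positivity)]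
  linarith

/-- The derivatives of the cutoffs are bounded uniformly in `n`, since the rescaling factors
`1 / (n + 1)` are at most `1`. -/
theorem norm_fderiv_truncate_sub_le {d : ℕ} :
    ∃ C : ℝ, ∀ (w : 𝓢(Space d, ℂ)) (n : ℕ) (x : Space d),
      ‖fderiv ℝ (truncate w n) x - fderiv ℝ w x‖ ≤ ‖fderiv ℝ w x‖ + C * ‖w x‖ := by
  have hcd : ContDiff ℝ 1 (bump d) := (bump d).contDiff
  obtain ⟨C, hC⟩ := ((bump d).hasCompactSupport.fderiv (𝕜 := ℝ)).exists_bound_of_continuous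
    (hcd.continuous_fderiv one_ne_zero)
  have hC0 : 0 ≤ C := (norm_nonneg _).trans (hC 0)
  refine ⟨C, fun w n x => ?_⟩
  set k : ℝ := (n + 1 : ℝ)⁻¹ with hk
  have hk0 : 0 ≤ k := by positivity
  have hk1 : k ≤ 1 := inv_le_one_of_one_le₀ (by linarith [n.cast_nonneg (α := ℝ)])
  have h1 : HasFDerivAt (fun y : Space d => bump d (k • y))
      ((fderiv ℝ (bump d) (k • x)).comp (k • ContinuousLinearMap.id ℝ (Space d))) x := by
    have h := (hcd.differentiable one_ne_zero (k • x)).hasFDerivAt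
    exact h.comp x ((hasFDerivAt_id x).const_smul k)
  have h2 := h1.smul (w.hasFDerivAt x)
  have h3 : fderiv ℝ (truncate w n) x = _ := h2.fderiv
  rw [h3]
  have hb : ‖bump d (k • x) - 1‖ ≤ 1 := by
    rw [Real.norm_eq_abs, abs_le]
    constructor <;> linarith [(bump d).nonneg (x := k • x), (bump d).le_one (x := k • x)]
  have hD : ‖(fderiv ℝ (bump d) (k • x)).comp (k • ContinuousLinearMap.id ℝ (Space d))‖ ≤ C := by
    refine ContinuousLinearMap.opNorm_le_bound _ hC0 fun y => ?_
    rw [ContinuousLinearMap.comp_apply]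
    refine (ContinuousLinearMap.le_opNorm _ _).trans ?_
    refine mul_le_mul (hC _) ?_ (norm_nonneg _) hC0
    simp only [smul_apply, ContinuousLinearMap.id_apply, norm_smul,
      Real.norm_of_nonneg hk0]
    nlinarith [norm_nonneg y]
  calc _ = ‖(bump d (k • x) - 1) • fderiv ℝ w x
        + ((fderiv ℝ (bump d) (k • x)).comp
          (k • ContinuousLinearMap.id ℝ (Space d))).smulRight (w x)‖ := by
        congr 1
        ext y
        simp only [add_apply, sub_apply, smul_apply, Complex.real_smul, Complex.ofReal_sub,
          Complex.ofReal_one]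
        ring
    _ ≤ _ := by
        refine (norm_add_le _ _).trans ?_
        rw [norm_smul, ContinuousLinearMap.norm_smulRight_apply]
        have := norm_nonneg (fderiv ℝ w x)
        gcongr
        nlinarith

/-- Schwartz functions belong to `H¹₀`, because cutoffs of them converge in the `H¹`-norm. -/
theorem toLp_mem_H10 {d : ℕ} (w : 𝓢(Space d, ℂ)) :
    ((w.toLp 2, (gradS w).toLp 2) : L2 d × L2Vec d) ∈ H10 d := by
  obtain ⟨C, hC⟩ := norm_fderiv_truncate_sub_le (d := d)
  have h1 : Tendsto (fun n => testL2 d (truncate w n)) atTop (𝓝 (w.toLp 2)) := by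
    refine tendsto_toLp_of_dominated (fun n => memLp_test (truncate w n)) (w.memLp 2)
      (w.memLp 2).norm (fun n x => ?_) fun x => ?_
    · rw [truncate_apply]
      set b := bump d ((n + 1 : ℝ)⁻¹ • x)
      have : b • w x - w x = (b - 1) • w x := by rw [sub_smul, one_smul]
      rw [this, norm_smul]
      refine mul_le_of_le_one_left (norm_nonneg _) ?_
      rw [Real.norm_eq_abs, abs_le]
      constructor <;> linarith [(bump d).nonneg (x := (n + 1 : ℝ)⁻¹ • x),
        (bump d).le_one (x := (n + 1 : ℝ)⁻¹ • x)]
    · refine tendsto_const_nhds.congr' ?_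
      filter_upwards [truncate_eventuallyEq w x] with n hn using hn.self_of_nhds.symm
  have h2 : Tendsto (fun n => testGrad d (truncate w n)) atTop (𝓝 ((gradS w).toLp 2)) := by
    refine tendsto_toLp_of_dominated (fun n => memLp_grad (truncate w n)) ((gradS w).memLp 2)
      (b := fun x => ‖gradL d‖ * (‖fderiv ℝ w x‖ + C * ‖w x‖)) ?_ (fun n x => ?_) fun x => ?_
    · exact ((((fderivCLM ℝ (Space d) ℂ w).memLp 2).norm).add
        ((w.memLp 2).norm.const_mul C)).const_mul _
    · rw [gradS_apply, ← gradL_fderiv, ← gradL_fderiv, ← map_sub]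
      exact (ContinuousLinearMap.le_opNorm _ _).trans (by gcongr; exact hC w n x)
    · refine tendsto_const_nhds.congr' ?_
      filter_upwards [truncate_eventuallyEq w x] with n hn
      rw [gradS_apply, ← gradL_fderiv, ← gradL_fderiv, hn.fderiv_eq]
  refine mem_closure_of_tendsto (h1.prodMk_nhds h2) (Eventually.of_forall fun n => ?_)
  exact ⟨truncate w n, rfl⟩

/-! ### Fourier multipliers -/

section Multiplier

variable {d : ℕ} {E : Type*} [NormedAddCommGroup E] [NormedSpace ℂ E]

/-- Multiplication of scalar `L²` functions by a bounded function `m`. -/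
def multiplier {ν : Measure (Space d)} {m : Space d → E} (hm : MemLp m ∞ ν) :
    Lp ℂ 2 ν →L[ℂ] Lp E 2 ν :=
  ((ContinuousLinearMap.lsmul ℂ ℂ : ℂ →L[ℂ] E →L[ℂ] E).flip).holderL ν ∞ 2 2 (hm.toLp m)

theorem coeFn_multiplier {ν : Measure (Space d)} {m : Space d → E} (hm : MemLp m ∞ ν)
    (y : Lp ℂ 2 ν) : multiplier hm y =ᵐ[ν] fun ξ => y ξ • m ξ := by
  filter_upwards [ContinuousLinearMap.coeFn_holder (r := 2)
    (ContinuousLinearMap.lsmul ℂ ℂ : ℂ →L[ℂ] E →L[ℂ] E).flip (hm.toLp m) y,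
    hm.coeFn_toLp] with ξ h1 h2
  refine h1.trans ?_
  rw [h2]
  rfl

end Multiplier

/-- Extension by zero of `L²` functions on a measurable set. -/
def extendByZero {d : ℕ} {B : Set (Space d)} (hB : MeasurableSet B) :
    Lp ℂ 2 (volume.restrict B) →ₗᵢ[ℂ] L2 d where
  toFun y := ((memLp_indicator_iff_restrict hB).2 (Lp.memLp y)).toLp (B.indicator y)
  map_add' y z := by
    rw [← MemLp.toLp_add]
    refine MemLp.toLp_congr _ _ ?_
    filter_upwards [(ae_restrict_iff' hB).1 (Lp.coeFn_add y z)] with ξ h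
    by_cases hξ : ξ ∈ B
    · simp only [Pi.add_apply, indicator_of_mem hξ]
      exact h hξ
    · simp [hξ]
  map_smul' c y := by
    rw [RingHom.id_apply, ← MemLp.toLp_const_smul]
    refine MemLp.toLp_congr _ _ ?_
    filter_upwards [(ae_restrict_iff' hB).1 (Lp.coeFn_smul c y)] with ξ h
    by_cases hξ : ξ ∈ B
    · simp [hξ, h hξ]
    · simp [hξ]
  norm_map' y := by
    change ‖((memLp_indicator_iff_restrict hB).2 (Lp.memLp y)).toLp (B.indicator y)‖ = ‖y‖
    rw [Lp.norm_toLp, eLpNorm_indicator_eq_eLpNorm_restrict hB, Lp.norm_def]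

theorem coeFn_extendByZero {d : ℕ} {B : Set (Space d)} (hB : MeasurableSet B)
    (y : Lp ℂ 2 (volume.restrict B)) : extendByZero hB y =ᵐ[volume] B.indicator y :=
  ((memLp_indicator_iff_restrict hB).2 (Lp.memLp y)).coeFn_toLp

/-- The Fourier symbol `2πi ξ` of the gradient. -/
def symbol {d : ℕ} (ξ : Space d) : EuclideanSpace ℂ (Fin d) :=
  WithLp.toLp 2 fun i => 2 * Real.pi * Complex.I * (ξ i : ℂ)

theorem norm_symbol {d : ℕ} (ξ : Space d) : ‖symbol ξ‖ = 2 * Real.pi * ‖ξ‖ := by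
  have h : ∀ i, ‖symbol ξ i‖ = 2 * Real.pi * ‖ξ i‖ := fun i => by
    simp [symbol, abs_of_pos Real.pi_pos]
  rw [EuclideanSpace.norm_eq, EuclideanSpace.norm_eq]
  simp only [h, mul_pow, ← Finset.mul_sum]
  rw [← mul_pow, Real.sqrt_mul (by positivity), Real.sqrt_sq (by positivity)]

theorem continuous_symbol {d : ℕ} : Continuous (symbol (d := d)) := by
  unfold symbol
  fun_prop

theorem inner_symbol_self {d : ℕ} (ξ : Space d) :
    inner ℂ (symbol ξ) (symbol ξ) = ((2 * Real.pi * ‖ξ‖) ^ 2 : ℝ) := by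
  rw [inner_self_eq_norm_sq_to_K, norm_symbol]
  norm_cast

/-- The Fourier transform turns the gradient into multiplication by `2πi ξ`. -/
theorem fourier_gradS {d : ℕ} (w : 𝓢(Space d, ℂ)) (ξ : Space d) :
    𝓕 (gradS w) ξ = 𝓕 w ξ • symbol ξ := by
  ext i
  have h1 : 𝓕 (gradS w) ξ i = 𝓕 (LineDeriv.lineDerivOp (EuclideanSpace.single i (1 : ℝ)) w) ξ := by
    rw [fourier_coe, fourier_coe, Real.fourier_eq, Real.fourier_eq]
    have hint : Integrable fun v => Real.fourierChar (-inner ℝ v ξ) • gradS w v := by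
      exact (Real.fourierIntegral_convergent_iff ξ).2 (gradS w).integrable
    have := (EuclideanSpace.proj (𝕜 := ℂ) i).integral_comp_comm hint
    exact this.symm
  rw [h1, fourier_lineDerivOp_eq]
  have ht : (fun x : Space d => inner ℝ x (EuclideanSpace.single i (1 : ℝ))).HasTemperateGrowth :=
    Function.hasTemperateGrowth_inner_left _
  rw [smul_apply, smulLeftCLM_apply_apply ht, EuclideanSpace.inner_single_right]
  simp [symbol]
  ring

theorem memLp_bump (d : ℕ) :
    MemLp (fun ξ : Space d => (bump d ξ : ℂ)) ∞ (volume : Measure (Space d)) := by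
  refine Continuous.memLp_of_hasCompactSupport ?_ ?_
  · exact Complex.continuous_ofReal.comp (bump d).continuous
  · exact (bump d).hasCompactSupport.comp_left Complex.ofReal_zero

theorem memLp_bump_smul_symbol (d : ℕ) :
    MemLp (fun ξ : Space d => (bump d ξ : ℂ) • symbol ξ) ∞ (volume : Measure (Space d)) := by
  refine Continuous.memLp_of_hasCompactSupport ?_ ?_
  · exact (Complex.continuous_ofReal.comp (bump d).continuous).smul continuous_symbol
  · exact ((bump d).hasCompactSupport.comp_left Complex.ofReal_zero).smul_right

/-- Restriction of the frequencies by the cutoff `bump d`, followed by inverse Fourier transform;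
an `L²` function is sent to the resulting function and its gradient. -/
def bandLimitL (d : ℕ) : L2 d →L[ℂ] L2 d × L2Vec d :=
  (((Lp.fourierTransformₗᵢ (Space d) ℂ).symm.toContinuousLinearEquiv.toContinuousLinearMap).comp
    (multiplier (memLp_bump d))).prod
  (((Lp.fourierTransformₗᵢ (Space d)
      (EuclideanSpace ℂ (Fin d))).symm.toContinuousLinearEquiv.toContinuousLinearMap).comp
    (multiplier (memLp_bump_smul_symbol d)))

theorem bandLimitL_apply {d : ℕ} (y : L2 d) : bandLimitL d y =
    (𝓕⁻ (multiplier (memLp_bump d) y), 𝓕⁻ (multiplier (memLp_bump_smul_symbol d) y)) := rfl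

/-- The product of a Schwartz function with the cutoff `bump d`. -/
def bumpMul {d : ℕ} (ψ : 𝓢(Space d, ℂ)) : 𝓢(Space d, ℂ) :=
  smulLeftCLM ℂ (fun ξ : Space d => (bump d ξ : ℂ)) ψ

theorem bumpMul_apply {d : ℕ} (ψ : 𝓢(Space d, ℂ)) (ξ : Space d) :
    bumpMul ψ ξ = (bump d ξ : ℂ) * ψ ξ := by
  have hcd : ContDiff ℝ (⊤ : ℕ∞) fun ξ : Space d => (bump d ξ : ℂ) :=
    Complex.ofRealCLM.contDiff.comp (bump d).contDiff
  have hχ : (fun ξ : Space d => (bump d ξ : ℂ)).HasTemperateGrowth :=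
    HasCompactSupport.hasTemperateGrowth
      ((bump d).hasCompactSupport.comp_left Complex.ofReal_zero) hcd
  rw [bumpMul, smulLeftCLM_apply_apply hχ, smul_eq_mul]

theorem multiplier_bump_toLp {d : ℕ} (ψ : 𝓢(Space d, ℂ)) :
    multiplier (memLp_bump d) (ψ.toLp 2) = (bumpMul ψ).toLp 2 := by
  refine Lp.ext ?_
  filter_upwards [coeFn_multiplier (memLp_bump d) (ψ.toLp 2), ψ.coeFn_toLp 2 volume,
    (bumpMul ψ).coeFn_toLp 2 volume] with ξ e1 e2 e3
  rw [e1, e2, e3, bumpMul_apply, smul_eq_mul, mul_comm]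

theorem multiplier_bump_smul_symbol_toLp {d : ℕ} (ψ : 𝓢(Space d, ℂ))
    (G : 𝓢(Space d, EuclideanSpace ℂ (Fin d))) (hG : ∀ ξ, G ξ = bumpMul ψ ξ • symbol ξ) :
    multiplier (memLp_bump_smul_symbol d) (ψ.toLp 2) = G.toLp 2 := by
  refine Lp.ext ?_
  filter_upwards [coeFn_multiplier (memLp_bump_smul_symbol d) (ψ.toLp 2),
    ψ.coeFn_toLp 2 volume, G.coeFn_toLp 2 volume] with ξ e1 e2 e3
  rw [e1, e2, e3, hG, bumpMul_apply, smul_smul, mul_comm]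

/-- Band-limited functions belong to `H¹₀`: the claim is closed in `L²`, and holds for Schwartz
functions, which the cutoff of frequencies sends to Schwartz functions. -/
theorem bandLimitL_mem {d : ℕ} (y : L2 d) : bandLimitL d y ∈ H10 d := by
  refine DenseRange.induction_on
    (SchwartzMap.denseRange_toLpCLM (E := Space d) (F := ℂ) (μ := volume) (p := 2)
      ENNReal.ofNat_ne_top) y
    ?_ fun ψ => ?_
  · exact (Submodule.isClosed_topologicalClosure _).preimage (bandLimitL d).continuous
  · have h2 := multiplier_bump_smul_symbol_toLp ψ (𝓕 (gradS (𝓕⁻ (bumpMul ψ)))) fun ξ => by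
      rw [fourier_gradS, fourier_fourierInv_eq]
    rw [toLpCLM_apply, bandLimitL_apply, multiplier_bump_toLp, h2, toLp_fourierInv_eq,
      toLp_fourierInv_eq, fourierInv_fourier_eq]
    exact toLp_mem_H10 _

/-- The map `bandLimitL`, with values in `H¹₀`. -/
def bandLimit (d : ℕ) : L2 d →L[ℂ] H10 d := (bandLimitL d).codRestrict (H10 d) bandLimitL_mem

theorem fn_bandLimit {d : ℕ} (y : L2 d) :
    fn (bandLimit d y) = 𝓕⁻ (multiplier (memLp_bump d) y) := rfl

theorem gradient_bandLimit {d : ℕ} (y : L2 d) :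
    gradient (bandLimit d y) = 𝓕⁻ (multiplier (memLp_bump_smul_symbol d) y) := rfl

theorem norm_fn_bandLimit {d : ℕ} (y : L2 d) :
    ‖fn (bandLimit d y)‖ = ‖multiplier (memLp_bump d) y‖ :=
  (Lp.fourierTransformₗᵢ (Space d) ℂ).symm.norm_map _

theorem norm_gradient_bandLimit {d : ℕ} (y : L2 d) :
    ‖gradient (bandLimit d y)‖ = ‖multiplier (memLp_bump_smul_symbol d) y‖ :=
  (Lp.fourierTransformₗᵢ (Space d) (EuclideanSpace ℂ (Fin d))).symm.norm_map _

/-- A test function, as a Schwartz function. -/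
def testS {d : ℕ} (φ : Test d) : 𝓢(Space d, ℂ) := φ.hasCompactSupport.toSchwartzMap φ.contDiff

theorem toLp_testS {d : ℕ} (φ : Test d) : (testS φ).toLp 2 volume = testL2 d φ := rfl

theorem toLp_gradS_testS {d : ℕ} (φ : Test d) : (gradS (testS φ)).toLp 2 volume = testGrad d φ := rfl

/-- Plancherel's theorem for a Schwartz function and the inverse transform of an `L²` function. -/
theorem inner_toLp_fourierInv {d : ℕ} {E : Type*} [NormedAddCommGroup E] [InnerProductSpace ℂ E]
    [CompleteSpace E] (w : 𝓢(Space d, E)) (y : Lp E 2 (volume : Measure (Space d))) :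
    inner ℂ (w.toLp 2 volume) (𝓕⁻ y) = ∫ ξ, inner ℂ (𝓕 w ξ) (y ξ) := by
  rw [← Lp.inner_fourier_eq, fourier_fourierInv_eq, toLp_fourier_eq, L2.inner_def]
  refine integral_congr_ae ?_
  filter_upwards [(𝓕 w).coeFn_toLp 2 volume] with ξ h
  rw [h]

/-- The weak form of `Δ = -|2πξ|²` on band-limited functions. -/
theorem neg_inner_gradient_bandLimit {d : ℕ} (φ : Test d) {y z : L2 d}
    (hyz : ∀ᵐ ξ, z ξ = -((2 * Real.pi * ‖ξ‖) ^ 2 : ℝ) * y ξ) :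
    -inner ℂ (testGrad d φ) (gradient (bandLimit d y))
      = inner ℂ (testL2 d φ) (fn (bandLimit d z)) := by
  rw [← toLp_testS, ← toLp_gradS_testS, gradient_bandLimit, fn_bandLimit, inner_toLp_fourierInv,
    inner_toLp_fourierInv, ← integral_neg]
  refine integral_congr_ae ?_
  filter_upwards [hyz, coeFn_multiplier (memLp_bump_smul_symbol d) y,
    coeFn_multiplier (memLp_bump d) z] with ξ e1 e2 e3
  rw [e2, e3, e1, fourier_gradS, inner_smul_left, inner_smul_right, inner_smul_right,
    inner_symbol_self]
  simp only [RCLike.inner_apply, smul_eq_mul]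
  ring

/-! ### Packets concentrated at a frequency -/

theorem mul_norm_le_norm_of_ae_mul_le {α E F : Type*} [MeasurableSpace α] {ν : Measure α}
    [NormedAddCommGroup E] [NormedAddCommGroup F] {p : ℝ≥0∞} [Fact (1 ≤ p)] {c : ℝ} {f : Lp E p ν} {g : Lp F p ν}
    (h : ∀ᵐ x ∂ν, c * ‖g x‖ ≤ ‖f x‖) : c * ‖g‖ ≤ ‖f‖ := by
  rcases le_or_gt c 0 with hc | hc
  · exact (mul_nonpos_of_nonpos_of_nonneg hc (norm_nonneg g)).trans (norm_nonneg f)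
  · rw [← le_inv_mul_iff₀ hc]
    refine Lp.norm_le_mul_norm_of_ae_le_mul ?_
    filter_upwards [h] with x hx
    rwa [le_inv_mul_iff₀ hc]

/-- The slow root of `λ² + λ + (2π|ξ|)² = 0`, for `2π|ξ| ≤ 1/2`. -/
def slowRoot {d : ℕ} (ξ : Space d) : ℝ := (√(1 - 4 * (2 * Real.pi * ‖ξ‖) ^ 2) - 1) / 2

theorem continuous_slowRoot {d : ℕ} : Continuous (slowRoot (d := d)) := by
  unfold slowRoot
  fun_prop

theorem slowRoot_add_sq {d : ℕ} {ξ : Space d} (h : 2 * Real.pi * ‖ξ‖ ≤ 1 / 2) :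
    slowRoot ξ + slowRoot ξ ^ 2 = -(2 * Real.pi * ‖ξ‖) ^ 2 := by
  have h0 : 0 ≤ 2 * Real.pi * ‖ξ‖ := by positivity
  have hs := Real.sq_sqrt (show (0 : ℝ) ≤ 1 - 4 * (2 * Real.pi * ‖ξ‖) ^ 2 by nlinarith)
  rw [slowRoot]
  linear_combination (1 / 4) * hs

/-- The frequencies `ξ` with `2π|ξ|` close to `r` and slow root close to `-μ`. -/
def frequencies (d : ℕ) (μ r δ : ℝ) : Set (Space d) :=
  {ξ | 2 * Real.pi * ‖ξ‖ < 1 / 2 ∧ |2 * Real.pi * ‖ξ‖ - r| < δ ∧ |slowRoot ξ + μ| < δ}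

section Frequencies

variable {d : ℕ} {μ r δ : ℝ}

theorem isOpen_frequencies : IsOpen (frequencies d μ r δ) := by
  have h : Continuous fun ξ : Space d => 2 * Real.pi * ‖ξ‖ := by fun_prop
  exact (isOpen_lt h continuous_const).inter ((isOpen_lt (h.sub continuous_const).abs
    continuous_const).inter (isOpen_lt (continuous_slowRoot.add continuous_const).abs
    continuous_const))

theorem norm_le_one_of_mem {ξ : Space d} (h : ξ ∈ frequencies d μ r δ) : ‖ξ‖ ≤ 1 := by
  have h1 := h.1
  nlinarith [Real.pi_gt_three, norm_nonneg ξ]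

/-- The frequencies of length `r / 2π` with `r² = μ (1 - μ)` have slow root exactly `-μ`. -/
theorem frequencies_nonempty (hd : 1 ≤ d) (hμ : 0 < μ) (hμ2 : μ < 1 / 2) (hδ : 0 < δ) :
    (frequencies d μ (√(μ * (1 - μ))) δ).Nonempty := by
  have h0 : 0 ≤ μ * (1 - μ) := mul_nonneg hμ.le (by linarith)
  set r := √(μ * (1 - μ)) with hr
  have hr2 : r ^ 2 = μ * (1 - μ) := Real.sq_sqrt h0
  have hr0 : 0 ≤ r := Real.sqrt_nonneg _
  have hn : ‖(EuclideanSpace.single (⟨0, hd⟩ : Fin d) (r / (2 * Real.pi)) : Space d)‖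
      = r / (2 * Real.pi) := by
    rw [PiLp.norm_single, Real.norm_of_nonneg (by positivity)]
  have hk : 2 * Real.pi * (r / (2 * Real.pi)) = r := by field_simp
  refine ⟨EuclideanSpace.single ⟨0, hd⟩ (r / (2 * Real.pi)), ?_, ?_, ?_⟩
  · rw [hn, hk]
    nlinarith
  · rw [hn, hk]
    simpa using hδ
  · rw [slowRoot, hn, hk, hr2, show 1 - 4 * (μ * (1 - μ)) = (1 - 2 * μ) ^ 2 by ring,
      Real.sqrt_sq (by linarith)]
    rw [show (1 - 2 * μ - 1) / 2 + μ = 0 by ring]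
    simpa using hδ

theorem memLp_slowRoot : MemLp (fun ξ : Space d => (slowRoot ξ : ℂ)) ∞
    (volume.restrict (frequencies d μ r δ)) := by
  refine memLp_top_of_bound
    (Complex.continuous_ofReal.comp continuous_slowRoot).aestronglyMeasurable (|μ| + δ) ?_
  filter_upwards [ae_restrict_mem isOpen_frequencies.measurableSet] with ξ hξ
  rw [Complex.norm_real, Real.norm_eq_abs]
  have h1 := abs_sub_abs_le_abs_sub (slowRoot ξ) (-μ)
  rw [abs_neg, sub_neg_eq_add] at h1
  linarith [hξ.2.2]

/-- The embedding into `H¹₀` of the functions with Fourier transform supported in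
`frequencies d μ r δ`: extension of the Fourier transform by zero, then Fourier inversion. -/
def packetMap (d : ℕ) (μ r δ : ℝ) : Lp ℂ 2 (volume.restrict (frequencies d μ r δ)) →L[ℂ] H10 d :=
  (bandLimit d).comp
    (extendByZero isOpen_frequencies.measurableSet).toContinuousLinearMap

/-- The generator of the slow solutions on `frequencies d μ r δ`: on the Fourier side,
multiplication by the slow root. -/
def packetGenerator (d : ℕ) (μ r δ : ℝ) : Lp ℂ 2 (volume.restrict (frequencies d μ r δ)) →L[ℂ]
    Lp ℂ 2 (volume.restrict (frequencies d μ r δ)) := multiplier memLp_slowRoot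

theorem coeFn_packetGenerator (y : Lp ℂ 2 (volume.restrict (frequencies d μ r δ))) :
    packetGenerator d μ r δ y =ᵐ[volume.restrict (frequencies d μ r δ)]
      fun ξ => y ξ * (slowRoot ξ : ℂ) :=
  coeFn_multiplier memLp_slowRoot y

/-- The slow root solves the characteristic equation, so its multiplier solves `Λ + Λ² = Δ`. -/
theorem isPacket : IsPacket (packetMap d μ r δ) (packetGenerator d μ r δ) := by
  refine ⟨fun φ y => neg_inner_gradient_bandLimit φ ?_⟩
  have hB := (isOpen_frequencies (d := d) (μ := μ) (r := r) (δ := δ)).measurableSet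
  set Λ := packetGenerator d μ r δ
  have e : ∀ᵐ ξ ∂(volume.restrict (frequencies d μ r δ)),
      (Λ y + Λ (Λ y)) ξ = -((2 * Real.pi * ‖ξ‖) ^ 2 : ℝ) * y ξ := by
    filter_upwards [Lp.coeFn_add (Λ y) (Λ (Λ y)), coeFn_packetGenerator y,
      coeFn_packetGenerator (Λ y), ae_restrict_mem hB] with ξ e1 e2 e3 hξ
    have h := slowRoot_add_sq hξ.1.le
    rw [e1, Pi.add_apply, e3, e2, ← Complex.ofReal_neg, ← h]
    push_cast
    ring
  filter_upwards [(ae_restrict_iff' hB).1 e, coeFn_extendByZero hB (Λ y + Λ (Λ y)),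
    coeFn_extendByZero hB y] with ξ e1 e2 e3
  refine e2.trans ?_
  change _ = -(((2 * Real.pi * ‖ξ‖) ^ 2 : ℝ) : ℂ) * extendByZero hB y ξ
  rw [e3]
  by_cases hξ : ξ ∈ frequencies d μ r δ
  · rw [indicator_of_mem hξ, indicator_of_mem hξ, e1 hξ]
  · rw [indicator_of_notMem hξ, indicator_of_notMem hξ, mul_zero]

/-- The cutoff `bump d` is `1` on the frequencies of a packet, so it leaves the norm unchanged. -/
theorem norm_fn_packetMap (y : Lp ℂ 2 (volume.restrict (frequencies d μ r δ))) :
    ‖fn (packetMap d μ r δ y)‖ = ‖y‖ := by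
  have hB := (isOpen_frequencies (d := d) (μ := μ) (r := r) (δ := δ)).measurableSet
  have h : multiplier (memLp_bump d) (extendByZero hB y) = extendByZero hB y := by
    refine Lp.ext ?_
    filter_upwards [coeFn_multiplier (memLp_bump d) (extendByZero hB y),
      coeFn_extendByZero hB y] with ξ e1 e2
    rw [e1, e2]
    by_cases hξ : ξ ∈ frequencies d μ r δ
    · simp [bump_eq_one (norm_le_one_of_mem hξ)]
    · simp [hξ]
  refine (norm_fn_bandLimit _).trans ?_
  exact (congrArg norm h).trans ((extendByZero hB).norm_map y)

theorem norm_multiplier_symbol_extendByZero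
    (y : Lp ℂ 2 (volume.restrict (frequencies d μ r δ))) :
    ∀ᵐ ξ, (r - δ) * ‖extendByZero isOpen_frequencies.measurableSet y ξ‖ ≤
        ‖multiplier (memLp_bump_smul_symbol d)
          (extendByZero isOpen_frequencies.measurableSet y) ξ‖ ∧
      ‖multiplier (memLp_bump_smul_symbol d)
          (extendByZero isOpen_frequencies.measurableSet y) ξ‖ ≤
        (r + δ) * ‖extendByZero isOpen_frequencies.measurableSet y ξ‖ := by
  have hB := (isOpen_frequencies (d := d) (μ := μ) (r := r) (δ := δ)).measurableSet
  filter_upwards [coeFn_multiplier (memLp_bump_smul_symbol d) (extendByZero hB y),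
    coeFn_extendByZero hB y] with ξ e1 e2
  rw [e1, norm_smul, norm_smul, norm_symbol]
  by_cases hξ : ξ ∈ frequencies d μ r δ
  · rw [bump_eq_one (norm_le_one_of_mem hξ), Complex.ofReal_one, norm_one, one_mul,
      mul_comm (r - δ), mul_comm (r + δ)]
    have h := abs_lt.1 hξ.2.1
    constructor <;> refine mul_le_mul_of_nonneg_left ?_ (norm_nonneg _) <;> linarith
  · rw [e2, indicator_of_notMem hξ]
    simp

theorem isConcentrated : IsConcentrated (packetMap d μ r δ) (packetGenerator d μ r δ) μ r δ where
  toIsPacket := isPacket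
  norm_fn := norm_fn_packetMap
  le_norm_gradient y := by
    have hB := (isOpen_frequencies (d := d) (μ := μ) (r := r) (δ := δ)).measurableSet
    refine le_trans ?_ (norm_gradient_bandLimit _).ge
    rw [← (extendByZero hB).norm_map y]
    refine mul_norm_le_norm_of_ae_mul_le ?_
    exact (norm_multiplier_symbol_extendByZero y).mono fun ξ h => h.1
  norm_gradient_le y := by
    have hB := (isOpen_frequencies (d := d) (μ := μ) (r := r) (δ := δ)).measurableSet
    refine (norm_gradient_bandLimit _).le.trans ?_
    rw [← (extendByZero hB).norm_map y]
    refine Lp.norm_le_mul_norm_of_ae_le_mul ?_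
    exact (norm_multiplier_symbol_extendByZero y).mono fun ξ h => h.2
  le_norm_apply y := by
    refine mul_norm_le_norm_of_ae_mul_le ?_
    filter_upwards [coeFn_packetGenerator y,
      ae_restrict_mem isOpen_frequencies.measurableSet] with ξ e hξ
    rw [e, norm_mul, Complex.norm_real, Real.norm_eq_abs, mul_comm]
    refine mul_le_mul_of_nonneg_left ?_ (norm_nonneg _)
    have h := abs_lt.1 hξ.2.2
    linarith [neg_abs_le (slowRoot ξ)]
  norm_apply_le y := by
    refine Lp.norm_le_mul_norm_of_ae_le_mul ?_
    filter_upwards [coeFn_packetGenerator y,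
      ae_restrict_mem isOpen_frequencies.measurableSet] with ξ e hξ
    rw [e, norm_mul, Complex.norm_real, Real.norm_eq_abs, mul_comm]
    refine mul_le_mul_of_nonneg_right ?_ (norm_nonneg _)
    have h := abs_lt.1 hξ.2.2
    have hs : slowRoot ξ ≤ 0 := by
      rw [slowRoot]
      have : √(1 - 4 * (2 * Real.pi * ‖ξ‖) ^ 2) ≤ 1 :=
        Real.sqrt_le_one.2 (by nlinarith [sq_nonneg (2 * Real.pi * ‖ξ‖)])
      linarith
    rw [abs_of_nonpos hs]
    linarith

theorem exists_norm_eq_one (h : (frequencies d μ r δ).Nonempty) :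
    ∃ z : Lp ℂ 2 (volume.restrict (frequencies d μ r δ)), ‖z‖ = 1 := by
  have hpos : 0 < volume (frequencies d μ r δ) := isOpen_frequencies.measure_pos _ h
  have hfin : volume (frequencies d μ r δ) < ∞ :=
    (measure_mono fun ξ hξ => by simpa using norm_le_one_of_mem hξ).trans_lt
      (measure_closedBall_lt_top (x := (0 : Space d)) (r := 1))
  have : IsFiniteMeasure (volume.restrict (frequencies d μ r δ)) := isFiniteMeasure_restrict.2 hfin.ne
  set z : Lp ℂ 2 (volume.restrict (frequencies d μ r δ)) :=
    indicatorConstLp 2 MeasurableSet.univ (measure_ne_top _ _) (1 : ℂ) with hz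
  have hz0 : z ≠ 0 := by
    rw [← norm_ne_zero_iff, hz, norm_indicatorConstLp two_ne_zero ENNReal.ofNat_ne_top]
    have : (volume.restrict (frequencies d μ r δ)).real univ ≠ 0 := by
      rw [measureReal_restrict_apply_univ]
      exact (ENNReal.toReal_pos hpos.ne' hfin.ne).ne'
    have h2 := this.symm.lt_of_le measureReal_nonneg
    exact mul_ne_zero (by simp) (Real.rpow_pos_of_pos h2 _).ne'
  exact ⟨((‖z‖ : ℂ)⁻¹) • z, norm_smul_inv_norm hz0⟩

end Frequencies

/-! ### The limit of concentrated packets and large times -/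

/-- In the limit `δ = 0` the data have the norm `√(μ + 1/μ)` of the exact mode, times `μ` (from the
factor `Λ` in the data). -/
theorem dataBound_zero {μ : ℝ} (hμ : 0 < μ) (hμ2 : μ < 1 / 2) :
    dataBound μ (√(μ * (1 - μ))) 0 = √μ * √(1 + μ ^ 2) := by
  have h0 : 0 ≤ μ * (1 - μ) := mul_nonneg hμ.le (by linarith)
  have hr2 : √(μ * (1 - μ)) ^ 2 = μ * (1 - μ) := Real.sq_sqrt h0
  rw [dataBound, ← Real.sqrt_mul hμ.le]
  congr 1
  linear_combination (μ ^ 2 + 1) * hr2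

theorem continuous_dataBound (μ r : ℝ) : Continuous (dataBound μ r) := by
  unfold dataBound
  fun_prop

/-- The ratios `‖u(t)‖ / ‖F‖`, `‖∇u(t)‖ / ‖F‖`, `‖∂ₜu(t)‖ / ‖F‖` of the ideal mode `e^{-μt}`, up to a
factor `√((1 - μ) / (1 + μ²))`, bound the decay rates from below. -/
theorem mode_le_rate {d : ℕ} (hd : 1 ≤ d) {μ : ℝ} (hμ : 0 < μ) (hμ2 : μ < 1 / 2)
    {t a₀ a₁ a₂ : ℝ} (ht : 0 < t) (h₀ : 0 ≤ a₀) (h₁ : 0 ≤ a₁) (h₂ : 0 ≤ a₂)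
    (hbound : ∀ F ∈ K d, ∀ u : ℝ → H10 d, IsSolution F u →
      ‖fn (u t)‖ ≤ a₀ * normK F ∧ ‖gradient (u t)‖ ≤ a₁ * normK F ∧
      ‖deriv (fun s : ℝ => fn (u s)) t‖ ≤ a₂ * normK F) :
    √μ * Real.exp (-(t * μ)) * (√(1 - μ) / √(1 + μ ^ 2)) ≤ a₀ ∧
    μ * Real.exp (-(t * μ)) * (√(1 - μ) / √(1 + μ ^ 2)) ≤ a₁ ∧
    μ * √μ * Real.exp (-(t * μ)) * (√(1 - μ) / √(1 + μ ^ 2)) ≤ a₂ := by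
  have hr : √(μ * (1 - μ)) = √μ * √(1 - μ) := Real.sqrt_mul hμ.le _
  have hr0 : 0 < √(μ * (1 - μ)) := Real.sqrt_pos.2 (mul_pos hμ (by linarith))
  have hD := dataBound_zero hμ hμ2
  set r := √(μ * (1 - μ))
  have hev : ∀ᶠ δ in 𝓝[>] (0 : ℝ),
      Real.exp (-(t * (μ + δ))) * (μ - δ) ≤ a₀ * dataBound μ r δ ∧
      (r - δ) * (Real.exp (-(t * (μ + δ))) * (μ - δ)) ≤ a₁ * dataBound μ r δ ∧
      (μ - δ) * (Real.exp (-(t * (μ + δ))) * (μ - δ)) ≤ a₂ * dataBound μ r δ := by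
    filter_upwards [self_mem_nhdsWithin, nhdsWithin_le_nhds (eventually_lt_nhds hμ),
      nhdsWithin_le_nhds (eventually_lt_nhds hr0)] with δ hδ h1 h2
    obtain ⟨z, hz⟩ := exists_norm_eq_one (frequencies_nonempty hd hμ hμ2 hδ)
    exact isConcentrated.le_rate hδ h1 h2 hz ht h₀ h₁ h₂ hbound
  have hc := continuous_dataBound μ r
  -- Both sides of each inequality are continuous in `δ`, so the inequalities hold for `δ = 0`.
  have limit : ∀ {f g : ℝ → ℝ}, Continuous f → Continuous g → (∀ᶠ δ in 𝓝[>] (0 : ℝ), f δ ≤ g δ) →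
      f 0 ≤ g 0 := fun hf hg h =>
    le_of_tendsto_of_tendsto (hf.continuousAt.mono_left nhdsWithin_le_nhds)
      (hg.continuousAt.mono_left nhdsWithin_le_nhds) h
  have e₀ := limit (by fun_prop) (by fun_prop) (hev.mono fun δ h => h.1)
  have e₁ := limit (by fun_prop) (by fun_prop) (hev.mono fun δ h => h.2.1)
  have e₂ := limit (by fun_prop) (by fun_prop) (hev.mono fun δ h => h.2.2)
  simp only [add_zero, sub_zero] at e₀ e₁ e₂
  rw [hD] at e₀ e₁ e₂
  rw [hr] at e₁
  have hs : 0 < √μ := Real.sqrt_pos.2 hμ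
  have hsq : √μ * √μ = μ := Real.mul_self_sqrt hμ.le
  have hq : 0 < √(1 + μ ^ 2) := Real.sqrt_pos.2 (by positivity)
  have hq1 : √(1 - μ) ≤ 1 := Real.sqrt_le_one.2 (by linarith)
  have hE := Real.exp_pos (-(t * μ))
  set E := Real.exp (-(t * μ))
  set q := √(1 + μ ^ 2)
  set p := √(1 - μ)
  have hp : 0 ≤ p := Real.sqrt_nonneg _
  refine ⟨?_, ?_, ?_⟩ <;> rw [← mul_div_assoc, div_le_iff₀ hq]
  · have h : √μ * (√μ * E) ≤ √μ * (a₀ * q) := by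
      linear_combination e₀ + E * hsq
    have h' := le_of_mul_le_mul_left h hs
    exact (mul_le_of_le_one_right (by positivity) hq1).trans h'
  · have h : √μ * (μ * E * p) ≤ √μ * (a₁ * q) := by
      linear_combination e₁
    exact le_of_mul_le_mul_left h hs
  · have h : √μ * (μ * √μ * E) ≤ √μ * (a₂ * q) := by
      linear_combination e₂ + μ * E * hsq
    have h' := le_of_mul_le_mul_left h hs
    exact (mul_le_of_le_one_right (by positivity) hq1).trans h'

theorem c_eq_rpow_mul_exp (j : ℕ) {s : ℝ} (hs : s = ((j : ℝ) + 1) / 2) :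
    c j = s ^ s * Real.exp (-s) := by
  have h0 : 0 ≤ s := by rw [hs]; positivity
  rw [c_eq, ← hs, show ((j : ℝ) + 1) / (2 * Real.exp 1) = s * Real.exp (-1) by
    rw [hs, Real.exp_neg]; field_simp, Real.mul_rpow h0 (Real.exp_pos _).le, ← Real.exp_mul]
  ring_nf

/-- The correction factor `√((1 - μ) / (1 + μ²))` at `μ = s / t` tends to `1`. -/
theorem eventually_sub_le_mul (a s : ℝ) {ε : ℝ} (hε : 0 < ε) :
    ∀ᶠ t : ℝ in atTop, a - ε ≤ a * (√(1 - s / t) / √(1 + (s / t) ^ 2)) := by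
  have h1 : Tendsto (fun t : ℝ => s / t) atTop (𝓝 0) := tendsto_const_nhds.div_atTop tendsto_id
  have h2 : ContinuousAt (fun x : ℝ => a * (√(1 - x) / √(1 + x ^ 2))) 0 := by
    refine ContinuousAt.mul continuousAt_const (ContinuousAt.div ?_ ?_ (by simp)) <;> fun_prop
  have h3 := h2.tendsto.comp h1
  simp only [sub_zero, Real.sqrt_one, ne_eq, OfNat.ofNat_ne_zero, not_false_eq_true, zero_pow,
    add_zero, div_one, mul_one] at h3
  exact (h3.eventually_const_lt (sub_lt_self a hε)).mono fun _ h => h.le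

end DampedWave

end

theorem mainTheorem4 (d : ℕ) (hd : 1 ≤ d) (ρ₀ ρ₁ ρ₂ : ℝ → ℝ)
    (hρ₀ : ∀ t : ℝ, 0 < t → 0 ≤ ρ₀ t) (hρ₁ : ∀ t : ℝ, 0 < t → 0 ≤ ρ₁ t)
    (hρ₂ : ∀ t : ℝ, 0 < t → 0 ≤ ρ₂ t)
    (hbound : ∀ F ∈ DampedWave.K d, ∀ u : ℝ → DampedWave.H10 d, DampedWave.IsSolution F u →
      ∀ t : ℝ, 0 < t →
        ‖DampedWave.fn (u t)‖ ≤ ρ₀ t * DampedWave.normK F ∧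
        ‖DampedWave.gradient (u t)‖ ≤ ρ₁ t * DampedWave.normK F ∧
        ‖deriv (fun s : ℝ => DampedWave.fn (u s)) t‖ ≤ ρ₂ t * DampedWave.normK F)
    (ε : ℝ) (hε : 0 < ε) :
    ∃ t₀ : ℝ, 1 ≤ t₀ ∧ ∀ t : ℝ, t₀ ≤ t →
      (DampedWave.c 0 - ε) / √t ≤ ρ₀ t ∧
      (DampedWave.c 1 - ε) / t ≤ ρ₁ t ∧
      (DampedWave.c 2 - ε) / t ^ (3 / 2 : ℝ) ≤ ρ₂ t := by
  obtain ⟨T, hT⟩ := Filter.eventually_atTop.1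
    ((DampedWave.eventually_sub_le_mul (DampedWave.c 0) (1 / 2) hε).and
      ((DampedWave.eventually_sub_le_mul (DampedWave.c 1) 1 hε).and
        (DampedWave.eventually_sub_le_mul (DampedWave.c 2) (3 / 2) hε)))
  refine ⟨max T 4, le_max_of_le_right (by norm_num), fun t ht => ?_⟩
  have ht4 : 4 ≤ t := (le_max_right _ _).trans ht
  have ht0 : 0 < t := by linarith
  obtain ⟨l₀, l₁, l₂⟩ := hT t ((le_max_left _ _).trans ht)
  -- The mode with `μ = s / t` maximizes the ratio for `s = (j + 1) / 2`.
  have key : ∀ s : ℝ, 0 < s → s ≤ 3 / 2 → _ := fun s hs hs2 =>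
    DampedWave.mode_le_rate hd (μ := s / t) (div_pos hs ht0)
      (by rw [div_lt_iff₀ ht0]; linarith) ht0 (hρ₀ t ht0) (hρ₁ t ht0) (hρ₂ t ht0)
      fun F hF u hu => hbound F hF u hu t ht0
  have hexp : ∀ s : ℝ, t * (s / t) = s := fun s => mul_div_cancel₀ s ht0.ne'
  have hst : 0 < √t := Real.sqrt_pos.2 ht0
  have hpow : ∀ x : ℝ, 0 ≤ x → x ^ (3 / 2 : ℝ) = x * √x := fun x hx => by
    rw [show (3 / 2 : ℝ) = 1 + 1 / 2 by norm_num, Real.rpow_add_of_nonneg hx (by norm_num)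
      (by norm_num), Real.rpow_one, Real.sqrt_eq_rpow]
  refine ⟨?_, ?_, ?_⟩
  · refine le_trans ?_ (key (1 / 2) (by norm_num) (by norm_num)).1
    rw [hexp, div_le_iff₀ hst]
    refine l₀.trans (le_of_eq ?_)
    rw [DampedWave.c_eq_rpow_mul_exp 0 (s := 1 / 2) (by norm_num), ← Real.sqrt_eq_rpow,
      Real.sqrt_div (by norm_num) t]
    field_simp
  · refine le_trans ?_ (key 1 (by norm_num) (by norm_num)).2.1
    rw [hexp, div_le_iff₀ ht0]
    refine l₁.trans (le_of_eq ?_)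
    rw [DampedWave.c_eq_rpow_mul_exp 1 (s := 1) (by norm_num), Real.rpow_one]
    field_simp
  · refine le_trans ?_ (key (3 / 2) (by norm_num) (by norm_num)).2.2
    rw [hexp, hpow t ht0.le, div_le_iff₀ (mul_pos ht0 hst)]
    refine l₂.trans (le_of_eq ?_)
    rw [DampedWave.c_eq_rpow_mul_exp 2 (s := 3 / 2) (by norm_num), hpow _ (by norm_num),
      Real.sqrt_div (by norm_num) t]
    field_simp
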